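/- Let $T\in(0,\infty)$, let $(\Omega,\mathscr F,\mathbb P)$ be a probability space with a filtration $(\mathscr F_t)_{t\in[0,T]}$, and let $S=(S_t)_{t\in[0,T]}$ be a continuous semimartingale with strictly positive paths whose quadratic variation process $\langle S\rangle$ satisfies $\langle S\rangle_T=0$ $\mathbb P$-a.s. Let $\phi=(\phi_t)_{t\in[0,T]}$ be a non-negative process, not necessarily adapted to $(\mathscr F_t)$, whose sample paths are càglàd (left-continuous with right limits) and of finite variation on $[0,T]$, such that $$\mathbb P\big(\phi_t>0\text{ for some }t\in[0,T]\big)>0 .$$ Then, $\mathbb P$-almost surely, the pathwise Riemann--Stieltjes integral $\int_0^t\phi_u\,\mathrm dS_u$ exists for every $t\in[0,T]$, and $$\mathbb P\Big(\int_0^t\phi_u\,\mathrm dS_u<\phi_tS_t\text{ for some }t\in[0,T]\Big)>0 .$$ -/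

import Mathlib

open MeasureTheory ProbabilityTheory Filter Topology
open scoped NNReal

/-- The time interval `[0, T]`; its least element is `⊥ = 0` and its greatest is `⊤ = T`. -/
abbrev TimeInterval (T : ℝ≥0) : Type := Set.Iic T

/-- `I` is the Riemann-Stieltjes integral of `f` against `g` over `[0, T]`: the sums
`∑ f (ξ i) * (g (τ (i + 1)) - g (τ i))` over partitions `0 = τ 0 ≤ τ 1 ≤ ⋯ ≤ τ n = T` with tags
`ξ i ∈ [τ i, τ (i + 1)]` converge to `I` as the mesh of the partition tends to zero. -/
def HasRSIntegral {T : ℝ≥0} (f g : TimeInterval T → ℝ) (I : ℝ) : Prop :=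
  ∀ ε : ℝ, 0 < ε → ∃ δ : ℝ, 0 < δ ∧
    ∀ (n : ℕ) (τ ξ : ℕ → TimeInterval T), Monotone τ → τ 0 = ⊥ → τ n = ⊤ →
      (∀ i < n, τ i ≤ ξ i ∧ ξ i ≤ τ (i + 1)) →
      (∀ i < n, dist (τ i) (τ (i + 1)) < δ) →
      |∑ i ∈ Finset.range n, f (ξ i) * (g (τ (i + 1)) - g (τ i)) - I| < ε

/-- `I` is the Riemann-Stieltjes integral `∫_0^t f dg`, computed from the sums
`∑ f (ξ i) * (g (t ∧ τ (i + 1)) - g (t ∧ τ i))` over partitions of `[0, T]`. -/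
def HasRSIntegralUpTo {T : ℝ≥0} (f g : TimeInterval T → ℝ) (t : TimeInterval T) (I : ℝ) : Prop :=
  HasRSIntegral f (fun u => g (min t u)) I

/-- Continuity from the left, with limits from the right. -/
def IsCaglad {T : ℝ≥0} (f : TimeInterval T → ℝ) : Prop :=
  ∀ t, ContinuousWithinAt f (Set.Iic t) t ∧ ∃ l : ℝ, Tendsto f (𝓝[>] t) (𝓝 l)

/-- Finite total variation over `[0, T]`. -/
def IsFiniteVariation {T : ℝ≥0} (f : TimeInterval T → ℝ) : Prop :=
  BoundedVariationOn f Set.univ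

section Processes

variable {Ω : Type*} {mΩ : MeasurableSpace Ω} {T : ℝ≥0}

/-- Continuous local martingales on `[0, T]`. Localizing sequences take values in `[0, T] ∪ {⊤}`
and are almost surely eventually equal to `⊤`. -/
structure IsContinuousLocalMartingale (𝓕 : Filtration (TimeInterval T) mΩ) (P : Measure Ω)
    (M : TimeInterval T → Ω → ℝ) : Prop where
  adapted : StronglyAdapted 𝓕 M
  continuous : ∀ᵐ ω ∂P, Continuous fun t => M t ω
  local_martingale : Locally (fun X => Martingale X 𝓕 P) 𝓕 M P

/-- `S = S_0 + M + A` with `M` a continuous local martingale, `A` a continuous adapted process of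
finite variation, and `M_0 = A_0 = 0`. -/
structure IsSemimartingaleDecomposition (𝓕 : Filtration (TimeInterval T) mΩ) (P : Measure Ω)
    (S M A : TimeInterval T → Ω → ℝ) : Prop where
  local_martingale : IsContinuousLocalMartingale 𝓕 P M
  martingale_zero : ∀ᵐ ω ∂P, M ⊥ ω = 0
  adapted : StronglyAdapted 𝓕 A
  continuous : ∀ᵐ ω ∂P, Continuous fun t => A t ω
  finite_variation : ∀ᵐ ω ∂P, IsFiniteVariation fun t => A t ω
  variation_zero : ∀ᵐ ω ∂P, A ⊥ ω = 0
  decomposition : ∀ᵐ ω ∂P, ∀ t, S t ω = S ⊥ ω + M t ω + A t ω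

/-- Continuous semimartingales on `[0, T]`. -/
def IsContinuousSemimartingale (𝓕 : Filtration (TimeInterval T) mΩ) (P : Measure Ω)
    (S : TimeInterval T → Ω → ℝ) : Prop :=
  StronglyAdapted 𝓕 S ∧ ∃ M A, IsSemimartingaleDecomposition 𝓕 P S M A

/-- `V` is (a version of) the quadratic variation process `⟨S⟩` of the continuous semimartingale
`S = S_0 + M + A`: the continuous, adapted, non-decreasing process with `V_0 = 0` such that
`M ^ 2 - V` is a continuous local martingale. -/
structure IsQuadraticVariation (𝓕 : Filtration (TimeInterval T) mΩ) (P : Measure Ω)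
    (S V : TimeInterval T → Ω → ℝ) : Prop where
  adapted : StronglyAdapted 𝓕 V
  continuous : ∀ᵐ ω ∂P, Continuous fun t => V t ω
  monotone : ∀ᵐ ω ∂P, Monotone fun t => V t ω
  zero : ∀ᵐ ω ∂P, V ⊥ ω = 0
  bracket : ∃ M A, IsSemimartingaleDecomposition 𝓕 P S M A ∧
    IsContinuousLocalMartingale 𝓕 P fun t ω => M t ω ^ 2 - V t ω

end Processes

/-!
A non-negative local martingale started at zero vanishes: each stopped martingale is non-negative
and has expectation zero. Since `⟨S⟩ = 0`, this applies to `M ^ 2 - ⟨S⟩ = M ^ 2`, where `M` is the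
local martingale part of `S` (`IsContinuousLocalMartingale.ae_eq_zero_of_nonneg`). Hence almost
every path of `S` is continuous and of finite variation
(`IsQuadraticVariation.continuous_and_finiteVariation`), and what remains concerns a single path.

Write a path `g` of `S` as a difference `p - q` of continuous non-decreasing functions. The measures
`dp` and `dq` are atomless, and a path `f` of `φ` is bounded with countably many discontinuities, so
the Riemann-Stieltjes sums converge to `∫ f dp - ∫ f dq` by dominated convergence
(`hasRSIntegral_integral`).

If `f t * g t ≤ ∫_0^t f dg` held for all `t`, then with `c = min g > 0` and `f ≥ 0` one would have
`c * f t ≤ ∫_0^t f dp`, and Gronwall's inequality for the atomless measure `dp`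
(`eq_zero_of_le_setIntegral_Iic`) would give `f = 0`. So the strict inequality occurs on almost every
path on which `φ` is not identically zero.
-/

/-! ### Non-negative local martingales started at zero -/

section LocalMartingale

variable {Ω : Type*} {mΩ : MeasurableSpace Ω} {T : ℝ≥0} {P : Measure Ω}
  {𝓕 : Filtration (TimeInterval T) mΩ}

lemma ae_eq_zero_of_martingale_of_nonneg [IsFiniteMeasure P] {Y : TimeInterval T → Ω → ℝ}
    (hY : Martingale Y 𝓕 P) (h0 : ∀ᵐ ω ∂P, Y ⊥ ω = 0) (hpos : ∀ᵐ ω ∂P, ∀ t, 0 ≤ Y t ω)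
    (t : TimeInterval T) : ∀ᵐ ω ∂P, Y t ω = 0 := by
  have hint : ∫ ω, Y t ω ∂P = 0 := by
    have h := hY.setIntegral_eq (bot_le (a := t)) MeasurableSet.univ
    simp only [setIntegral_univ] at h
    rw [← h]
    exact integral_eq_zero_of_ae h0
  exact (integral_eq_zero_iff_of_nonneg_ae (hpos.mono fun ω h => h t) (hY.integrable t)).1 hint

/-- A non-negative continuous local martingale started at zero vanishes identically: the stopped
martingales are non-negative with zero expectation. -/
lemma IsContinuousLocalMartingale.ae_eq_zero_of_nonneg [IsFiniteMeasure P]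
    {N : TimeInterval T → Ω → ℝ} (hN : IsContinuousLocalMartingale 𝓕 P N)
    (h0 : ∀ᵐ ω ∂P, N ⊥ ω = 0) (hpos : ∀ᵐ ω ∂P, ∀ t, 0 ≤ N t ω) :
    ∀ᵐ ω ∂P, ∀ t, N t ω = 0 := by
  obtain ⟨τ, hτ, hmart⟩ := hN.local_martingale
  have hfix : ∀ t, ∀ᵐ ω ∂P, N t ω = 0 := by
    intro t
    have hzero : ∀ n, ∀ᵐ ω ∂P,
        stoppedProcess (fun i ↦ {ω | ⊥ < τ n ω}.indicator (N i)) (τ n) t ω = 0 := by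
      intro n
      refine ae_eq_zero_of_martingale_of_nonneg (hmart n) ?_ ?_ t
      · filter_upwards [h0] with ω hω
        have hbot : min ((⊥ : TimeInterval T) : WithTop (TimeInterval T)) (τ n ω)
            = ((⊥ : TimeInterval T) : WithTop (TimeInterval T)) := min_eq_left bot_le
        rw [stoppedProcess, hbot, WithTop.untopA_eq_untop WithTop.coe_ne_top, WithTop.untop_coe]
        exact Set.indicator_apply_eq_zero.2 fun _ => hω
      · filter_upwards [hpos] with ω hω s
        exact Set.indicator_apply_nonneg fun _ => hω _
    filter_upwards [ae_all_iff.2 hzero, hτ.tendsto_top] with ω hω htop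
    obtain ⟨n, hn⟩ := (htop.eventually (lt_mem_nhds (WithTop.coe_lt_top t))).exists
    have h := hω n
    rw [stoppedProcess, min_eq_left hn.le, WithTop.untopA_eq_untop WithTop.coe_ne_top,
      WithTop.untop_coe, Set.indicator_of_mem (show ω ∈ {ω | ⊥ < τ n ω} from lt_of_le_of_lt bot_le hn)] at h
    exact h
  obtain ⟨D, hDc, hDd⟩ := TopologicalSpace.exists_countable_dense (TimeInterval T)
  have hD : ∀ᵐ ω ∂P, ∀ t ∈ D, N t ω = 0 := (ae_ball_iff hDc).2 fun t _ => hfix t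
  filter_upwards [hD, hN.continuous] with ω hω hcont
  exact congrFun (hcont.ext_on hDd continuous_const hω)

/-- A continuous semimartingale with vanishing quadratic variation has continuous paths of finite
variation, because its local martingale part is zero. -/
lemma IsQuadraticVariation.continuous_and_finiteVariation [IsFiniteMeasure P]
    {S V : TimeInterval T → Ω → ℝ} (hV : IsQuadraticVariation 𝓕 P S V)
    (hV_zero : ∀ᵐ ω ∂P, V ⊤ ω = 0) :
    ∀ᵐ ω ∂P, Continuous (fun t => S t ω) ∧ IsFiniteVariation fun t => S t ω := by
  obtain ⟨M, A, hdec, hM⟩ := hV.bracket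
  have hV0 : ∀ᵐ ω ∂P, ∀ t, V t ω = 0 := by
    filter_upwards [hV.monotone, hV.zero, hV_zero] with ω hmono h0 h1 t
    exact le_antisymm (h1 ▸ hmono le_top) (h0 ▸ hmono bot_le)
  have hM0 := hM.ae_eq_zero_of_nonneg
    (by filter_upwards [hdec.martingale_zero, hV.zero] with ω h1 h2; simp [h1, h2])
    (by filter_upwards [hV0] with ω h t; simpa [h t] using sq_nonneg (M t ω))
  filter_upwards [hM0, hV0, hdec.decomposition, hdec.continuous, hdec.finite_variation]
    with ω hMω hVω hS hA hAv
  have hSA : (fun t => S t ω) = fun t => S ⊥ ω + A t ω := by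
    funext t
    have h : M t ω = 0 := by simpa [hVω t] using hMω t
    rw [hS t, h, add_zero]
  rw [hSA]
  refine ⟨continuous_const.add hA, ?_⟩
  have : eVariationOn (fun t => S ⊥ ω + A t ω) Set.univ
      = eVariationOn (fun t => A t ω) Set.univ := by
    simp [eVariationOn, edist_add_left]
  rw [IsFiniteVariation, BoundedVariationOn, this]
  exact hAv

end LocalMartingale

/-! ### Riemann-Stieltjes integrals of functions of bounded variation -/

section RiemannStieltjes

variable {T : ℝ≥0}

instance : CompactSpace (TimeInterval T) := by
  have h : Set.Iic T = Set.Icc 0 T := by ext; simp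
  exact isCompact_iff_compactSpace.1 (h ▸ isCompact_Icc)

instance : CompactIccSpace (TimeInterval T) := ⟨fun {_ _} => isClosed_Icc.isCompact⟩

/-- The value at `u` of the step function belonging to a tagged partition: `f (ξ i)` if
`u ∈ (τ i, τ (i + 1)]`. -/
noncomputable def stepFunction (f : TimeInterval T → ℝ) (τ ξ : ℕ → TimeInterval T) (n : ℕ)
    (u : TimeInterval T) : ℝ :=
  ∑ i ∈ Finset.range n, (Set.Ioc (τ i) (τ (i + 1))).indicator (fun _ => f (ξ i)) u

variable {f : TimeInterval T → ℝ} {τ ξ : ℕ → TimeInterval T} {n : ℕ}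

lemma measurable_stepFunction : Measurable (stepFunction f τ ξ n) :=
  Finset.measurable_fun_sum _ fun _ _ => measurable_const.indicator measurableSet_Ioc

lemma stepFunction_eq (hτ : Monotone τ) {i : ℕ} (hi : i < n) {u : TimeInterval T}
    (hu : u ∈ Set.Ioc (τ i) (τ (i + 1))) : stepFunction f τ ξ n u = f (ξ i) := by
  rw [stepFunction, Finset.sum_eq_single_of_mem i (Finset.mem_range.2 hi),
    Set.indicator_of_mem hu]
  intro j _ hji
  exact Set.indicator_of_notMem
    (fun hj => Set.disjoint_left.1 (hτ.pairwise_disjoint_on_Ioc_succ hji) hj hu) _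

lemma exists_mem_Ioc_of_partition (hτ : Monotone τ) (h0 : τ 0 = ⊥) (hn : τ n = ⊤)
    {u : TimeInterval T} (hu : u ≠ ⊥) : ∃ i < n, u ∈ Set.Ioc (τ i) (τ (i + 1)) := by
  have h := hτ.biUnion_Ico_Ioc_map_succ 0 n
  rw [h0, hn] at h
  have hmem : u ∈ Set.Ioc (⊥ : TimeInterval T) ⊤ := ⟨bot_lt_iff_ne_bot.2 hu, le_top⟩
  rw [← h] at hmem
  simp only [Set.mem_iUnion] at hmem
  obtain ⟨i, hi, hiu⟩ := hmem
  exact ⟨i, hi.2, hiu⟩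

lemma integral_stepFunction {μ : Measure (TimeInterval T)} [IsFiniteMeasure μ]
    {g : TimeInterval T → ℝ} (hg : ∀ a b, a ≤ b → g b - g a = μ.real (Set.Ioc a b))
    (hτ : Monotone τ) :
    ∫ u, stepFunction f τ ξ n u ∂μ
      = ∑ i ∈ Finset.range n, f (ξ i) * (g (τ (i + 1)) - g (τ i)) := by
  unfold stepFunction
  rw [integral_finsetSum _ fun i _ => (integrable_const _).indicator measurableSet_Ioc]
  refine Finset.sum_congr rfl fun i _ => ?_
  rw [integral_indicator_const _ measurableSet_Ioc, hg _ _ (hτ i.le_succ), smul_eq_mul, mul_comm]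

/-- If `dg` is a finite atomless measure, then a bounded function that is almost everywhere
continuous is Riemann-Stieltjes integrable against `g`: along partitions of vanishing mesh, the
step functions converge almost everywhere and boundedly. -/
lemma hasRSIntegral_integral {μ : Measure (TimeInterval T)} [IsFiniteMeasure μ]
    [NullSingletonClass μ] {g : TimeInterval T → ℝ}
    (hg : ∀ a b, a ≤ b → g b - g a = μ.real (Set.Ioc a b)) {C : ℝ} (hC : ∀ u, |f u| ≤ C)
    (hf : ∀ᵐ u ∂μ, ContinuousAt f u) : HasRSIntegral f g (∫ u, f u ∂μ) := by
  intro ε hε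
  -- A failure yields a sequence of partitions with mesh tending to zero, to which dominated
  -- convergence applies.
  by_contra! hbad
  choose n τ ξ hτ h0 hn hξ hmesh hlarge using
    fun k : ℕ => hbad (1 / ((k : ℝ) + 1)) Nat.one_div_pos_of_nat
  have hne : ∀ᵐ u ∂μ, u ≠ ⊥ := by simp [ae_iff]
  have htag : ∀ k u, u ≠ ⊥ → ∃ v, stepFunction f (τ k) (ξ k) (n k) u = f v ∧
      dist v u < 1 / ((k : ℝ) + 1) := by
    intro k u hu
    obtain ⟨i, hi, hiu⟩ := exists_mem_Ioc_of_partition (hτ k) (h0 k) (hn k) hu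
    refine ⟨ξ k i, stepFunction_eq (hτ k) hi hiu, lt_of_le_of_lt ?_ (hmesh k i hi)⟩
    have h1 := (hξ k i hi).1
    have h2 := (hξ k i hi).2
    have h3 := hiu.1.le
    have h4 := hiu.2
    simp only [Subtype.dist_eq, NNReal.dist_eq, ← Subtype.coe_le_coe, ← NNReal.coe_le_coe]
      at h1 h2 h3 h4 ⊢
    rw [abs_le, abs_of_nonpos (by linarith)]
    constructor <;> linarith
  have hlim : Tendsto (fun k => ∫ u, stepFunction f (τ k) (ξ k) (n k) u ∂μ) atTop
      (𝓝 (∫ u, f u ∂μ)) := by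
    refine tendsto_integral_of_dominated_convergence (fun _ => C)
      (fun k => measurable_stepFunction.aestronglyMeasurable) (integrable_const C)
      (fun k => ?_) ?_
    · filter_upwards [hne] with u hu
      obtain ⟨v, hv, -⟩ := htag k u hu
      rw [hv]
      exact hC v
    · filter_upwards [hne, hf] with u hu hcont
      choose v hv hvu using fun k => htag k u hu
      have hvlim : Tendsto v atTop (𝓝 u) :=
        tendsto_iff_dist_tendsto_zero.2 <| squeeze_zero (fun _ => dist_nonneg)
          (fun k => (hvu k).le) tendsto_one_div_add_atTop_nhds_zero_nat
      simp only [hv]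
      exact hcont.tendsto.comp hvlim
  obtain ⟨k, hk⟩ := ((Metric.tendsto_nhds.1 hlim) ε hε).exists
  rw [integral_stepFunction hg (hτ k), Real.dist_eq] at hk
  exact absurd hk (not_lt.2 (hlarge k))

lemma HasRSIntegral.sub_integrator {g₁ g₂ : TimeInterval T → ℝ} {I₁ I₂ : ℝ}
    (h₁ : HasRSIntegral f g₁ I₁) (h₂ : HasRSIntegral f g₂ I₂) :
    HasRSIntegral f (fun u => g₁ u - g₂ u) (I₁ - I₂) := by
  intro ε hε
  obtain ⟨δ₁, hδ₁, H₁⟩ := h₁ (ε / 2) (half_pos hε)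
  obtain ⟨δ₂, hδ₂, H₂⟩ := h₂ (ε / 2) (half_pos hε)
  refine ⟨min δ₁ δ₂, lt_min hδ₁ hδ₂, fun n τ ξ hτ h0 hn hξ hmesh => ?_⟩
  have e₁ := H₁ n τ ξ hτ h0 hn hξ fun i hi => (hmesh i hi).trans_le (min_le_left _ _)
  have e₂ := H₂ n τ ξ hτ h0 hn hξ fun i hi => (hmesh i hi).trans_le (min_le_right _ _)
  have hsum : ∑ i ∈ Finset.range n, f (ξ i) * (g₁ (τ (i + 1)) - g₂ (τ (i + 1))
        - (g₁ (τ i) - g₂ (τ i)))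
      = ∑ i ∈ Finset.range n, f (ξ i) * (g₁ (τ (i + 1)) - g₁ (τ i))
        - ∑ i ∈ Finset.range n, f (ξ i) * (g₂ (τ (i + 1)) - g₂ (τ i)) := by
    rw [← Finset.sum_sub_distrib]
    exact Finset.sum_congr rfl fun i _ => by ring
  rw [hsum]
  rw [abs_lt] at *
  constructor <;> linarith [e₁.1, e₁.2, e₂.1, e₂.2]

namespace IsFiniteVariation

lemma countable_not_continuousAt (hf : IsFiniteVariation f) :
    {u | ¬ ContinuousAt f u}.Countable := by
  obtain ⟨p, q, hp, hq, rfl⟩ :=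
    (BoundedVariationOn.locallyBoundedVariationOn hf).exists_monotoneOn_sub_monotoneOn
  rw [monotoneOn_univ] at hp hq
  refine (hp.countable_not_continuousAt.union hq.countable_not_continuousAt).mono fun u hu => ?_
  by_contra h
  simp only [Set.mem_union, Set.mem_ofPred_eq, not_or, not_not] at h
  exact hu (h.1.sub h.2)

lemma exists_abs_le (hf : IsFiniteVariation f) : ∃ C, ∀ u, |f u| ≤ C := by
  refine ⟨|f ⊥| + (eVariationOn f Set.univ).toReal, fun u => ?_⟩
  have h := BoundedVariationOn.dist_le hf (Set.mem_univ u) (Set.mem_univ ⊥)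
  rw [Real.dist_eq] at h
  linarith [abs_sub_abs_le_abs_sub (f u) (f ⊥)]

lemma continuous_variationOnFromTo (hf : IsFiniteVariation f) (hfc : Continuous f) :
    Continuous (variationOnFromTo f Set.univ ⊥) := by
  refine continuous_iff_continuousAt.2 fun u => continuousAt_iff_continuous_left'_right'.2 ⟨?_, ?_⟩
  · have h := variationOnFromTo.tendsto_left (Set.mem_univ ⊥) (Set.mem_univ u)
      (BoundedVariationOn.locallyBoundedVariationOn hf)
      (hfc.tendsto u |>.mono_left nhdsWithin_le_nhds)
    simpa [ContinuousWithinAt] using h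
  · have h := variationOnFromTo.tendsto_right (Set.mem_univ ⊥) (Set.mem_univ u)
      (BoundedVariationOn.locallyBoundedVariationOn hf)
      (hfc.tendsto u |>.mono_left nhdsWithin_le_nhds)
    simpa [ContinuousWithinAt] using h

/-- Jordan decomposition within the class of continuous functions. -/
lemma exists_continuous_monotone_sub (hf : IsFiniteVariation f) (hfc : Continuous f) :
    ∃ p q : TimeInterval T → ℝ, Monotone p ∧ Monotone q ∧ Continuous p ∧ Continuous q ∧
      ∀ u, f u = p u - q u := by
  have hloc := BoundedVariationOn.locallyBoundedVariationOn hf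
  refine ⟨variationOnFromTo f Set.univ ⊥, variationOnFromTo f Set.univ ⊥ - f,
    monotoneOn_univ.1 (variationOnFromTo.monotoneOn hloc (Set.mem_univ _)),
    monotoneOn_univ.1 (variationOnFromTo.sub_self_monotoneOn hloc (Set.mem_univ _)),
    hf.continuous_variationOnFromTo hfc, (hf.continuous_variationOnFromTo hfc).sub hfc,
    fun u => by simp⟩

end IsFiniteVariation

/-- The measure `dp` of a continuous non-decreasing function `p`. -/
lemma exists_measure_of_continuous_monotone {p : TimeInterval T → ℝ}
    (hp : Monotone p) (hpc : Continuous p) :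
    ∃ μ : Measure (TimeInterval T), IsFiniteMeasure μ ∧ NullSingletonClass μ ∧
      ∀ a b, a ≤ b → p b - p a = μ.real (Set.Ioc a b) := by
  let F : StieltjesFunction (TimeInterval T) := ⟨p, hp, fun x => hpc.continuousWithinAt⟩
  refine ⟨F.measure, inferInstance, ⟨fun a => ?_⟩, fun a b hab => ?_⟩
  · rw [F.measure_singleton, (show ContinuousWithinAt F (Set.Iic a) a from
      hpc.continuousWithinAt).leftLim_eq, sub_self, ENNReal.ofReal_zero]
  · rw [measureReal_def, F.measure_Ioc, ENNReal.toReal_ofReal (sub_nonneg.2 (hp hab))]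

/-- Riemann-Stieltjes integrability of a function of finite variation against a continuous function
of finite variation, and a bound on the integral of non-negative functions by an integral with
respect to a positive measure. -/
lemma exists_measure_hasRSIntegralUpTo {g : TimeInterval T → ℝ} (hf : IsFiniteVariation f)
    (hg : IsFiniteVariation g) (hgc : Continuous g) :
    ∃ μ : Measure (TimeInterval T), IsFiniteMeasure μ ∧ NullSingletonClass μ ∧
      ∀ t, ∃ I, HasRSIntegralUpTo f g t I ∧
        ((∀ u, 0 ≤ f u) → I ≤ ∫ u in Set.Iic t, f u ∂μ) := by
  obtain ⟨p, q, hp, hq, hpc, hqc, hpq⟩ := hg.exists_continuous_monotone_sub hgc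
  obtain ⟨μ, hμ, hμ0, hμp⟩ := exists_measure_of_continuous_monotone hp hpc
  obtain ⟨ν, hν, hν0, hνq⟩ := exists_measure_of_continuous_monotone hq hqc
  obtain ⟨C, hC⟩ := hf.exists_abs_le
  have hincr : ∀ (m : Measure (TimeInterval T)) (r : TimeInterval T → ℝ) (t : TimeInterval T),
      (∀ a b, a ≤ b → r b - r a = m.real (Set.Ioc a b)) → ∀ a b, a ≤ b →
        r (min t b) - r (min t a) = (m.restrict (Set.Iic t)).real (Set.Ioc a b) := by
    intro m r t hr a b hab
    rw [hr _ _ (min_le_min_left t hab), measureReal_restrict_apply measurableSet_Ioc]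
    congr 1
    ext u
    simp only [Set.mem_Ioc, Set.mem_inter_iff, Set.mem_Iic, min_lt_iff, le_min_iff]
    grind
  refine ⟨μ, hμ, hμ0, fun t => ⟨∫ u in Set.Iic t, f u ∂μ - ∫ u in Set.Iic t, f u ∂ν, ?_, ?_⟩⟩
  · simp only [HasRSIntegralUpTo, hpq]
    exact (hasRSIntegral_integral (hincr μ p t hμp) hC
        (ae_iff.2 (hf.countable_not_continuousAt.measure_zero _))).sub_integrator
      (hasRSIntegral_integral (hincr ν q t hνq) hC
        (ae_iff.2 (hf.countable_not_continuousAt.measure_zero _)))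
  · intro hpos
    have : 0 ≤ ∫ u in Set.Iic t, f u ∂ν := integral_nonneg hpos
    linarith

end RiemannStieltjes

/-! ### A Gronwall inequality for atomless measures -/

section Gronwall

variable {T : ℝ≥0} {μ : Measure (TimeInterval T)} {f : TimeInterval T → ℝ} {L C : ℝ}

/-- Gronwall's inequality with zero initial value. If `f` vanishes before `a`, then it vanishes at
`a` since `{a}` is null, and on an interval to the right of `a` on which `L * μ ≤ 1 / 2` the
supremum of `f` is at most half of itself. -/
lemma eq_zero_of_le_setIntegral_Iic [IsFiniteMeasure μ] [NullSingletonClass μ]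
    (hf : ∀ t, 0 ≤ f t) (hC : ∀ t, f t ≤ C) (hL : 0 ≤ L)
    (hgron : ∀ t, f t ≤ L * ∫ u in Set.Iic t, f u ∂μ) (t : TimeInterval T) : f t = 0 := by
  -- If the supremum `a` of `A` is not `⊤`, then a point beyond `a` turns out to lie in `A`.
  let A : Set (TimeInterval T) := {t | ∀ u < t, f u = 0}
  have hbot : ⊥ ∈ A := fun u hu => absurd hu not_lt_bot
  obtain ⟨a, ha⟩ : ∃ a, IsLUB A a := by
    obtain ⟨a, -, ha⟩ := isClosed_closure.isCompact.exists_isLUB ⟨⊥, subset_closure hbot⟩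
    exact ⟨a, by rwa [IsLUB, upperBounds_closure] at ha⟩
  have hlt : ∀ u < a, f u = 0 := by
    intro u hu
    obtain ⟨s, hs, hus, -⟩ := ha.exists_between hu
    exact hs u hus
  have hle : ∀ u ≤ a, f u = 0 := by
    intro u hu
    rcases hu.lt_or_eq with hu | rfl
    · exact hlt u hu
    refine le_antisymm ((hgron u).trans_eq ?_) (hf u)
    rw [integral_Iic_eq_integral_Iio, (setIntegral_eq_zero_of_forall_eq_zero hlt :
      ∫ x in Set.Iio u, f x ∂μ = 0), mul_zero]
  by_cases htop : a = ⊤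
  · exact hle t (htop ▸ le_top)
  exfalso
  have hsmall : Tendsto (fun b => μ (Set.Ioc a b)) (𝓝[>] a) (𝓝 0) := by
    have h := tendsto_measure_biInter_gt (μ := μ) (s := fun b => Set.Ioc a b) (a := a)
      (fun b _ => measurableSet_Ioc.nullMeasurableSet)
      (fun i j _ hij => Set.Ioc_subset_Ioc_right hij)
      ⟨⊤, lt_top_iff_ne_top.2 htop, measure_ne_top _ _⟩
    have hempty : ⋂ b, ⋂ (_ : b > a), Set.Ioc a b = (∅ : Set (TimeInterval T)) := by
      refine Set.eq_empty_of_forall_notMem fun x hx => ?_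
      simp only [Set.mem_iInter] at hx
      have hax : a < x := (hx ⊤ (lt_top_iff_ne_top.2 htop)).1
      obtain ⟨b, hab, hbx⟩ := exists_between hax
      exact absurd (hx b hab).2 (not_le.2 hbx)
    rw [hempty, measure_empty] at h
    exact h
  have hsmall' : Tendsto (fun b => L * μ.real (Set.Ioc a b)) (𝓝[>] a) (𝓝 0) := by
    have h := ((ENNReal.tendsto_toReal ENNReal.zero_ne_top).comp hsmall).const_mul L
    simpa [measureReal_def, Function.comp_def] using h
  have : (𝓝[>] a).NeBot := nhdsGT_neBot_of_exists_gt ⟨⊤, lt_top_iff_ne_top.2 htop⟩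
  obtain ⟨b, hb, hab⟩ := ((hsmall'.eventually (gt_mem_nhds (one_half_pos (α := ℝ)))).and
    self_mem_nhdsWithin).exists
  have hhalf : ∀ n : ℕ, ∀ u ≤ b, f u ≤ C * (1 / 2) ^ n := by
    intro n
    induction n with
    | zero => intro u _; simpa using hC u
    | succ n ih =>
      intro u hu
      have hK : 0 ≤ C * (1 / 2 : ℝ) ^ n := (hf u).trans (ih u hu)
      rcases le_or_gt u a with hua | hau
      · rw [hle u hua, pow_succ]
        linarith
      have hint : ∫ x in Set.Iic u, f x ∂μ = ∫ x in Set.Ioc a u, f x ∂μ := by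
        refine (setIntegral_eq_of_subset_of_forall_sdiff_eq_zero measurableSet_Iic
          Set.Ioc_subset_Iic_self fun x hx => hle x ?_)
        by_contra! hax
        exact hx.2 ⟨hax, hx.1⟩
      have hbound : ∫ x in Set.Ioc a u, f x ∂μ ≤ C * (1 / 2) ^ n * μ.real (Set.Ioc a b) := by
        refine (Real.le_norm_self _).trans ((norm_setIntegral_le_of_norm_le_const
          (C := C * (1 / 2) ^ n) (measure_lt_top _ _) fun x hx => ?_).trans ?_)
        · rw [Real.norm_of_nonneg (hf x)]
          exact ih x (hx.2.trans hu)
        · exact mul_le_mul_of_nonneg_left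
            (measureReal_mono (Set.Ioc_subset_Ioc_right hu)) hK
      calc f u ≤ L * ∫ x in Set.Iic u, f x ∂μ := hgron u
        _ ≤ L * (C * (1 / 2) ^ n * μ.real (Set.Ioc a b)) := by
          rw [hint]
          exact mul_le_mul_of_nonneg_left hbound hL
        _ = C * (1 / 2) ^ n * (L * μ.real (Set.Ioc a b)) := by ring
        _ ≤ C * (1 / 2) ^ n * (1 / 2) := mul_le_mul_of_nonneg_left hb.le hK
        _ = C * (1 / 2) ^ (n + 1) := by ring
  have hbA : b ∈ A := by
    intro u hu
    have hlim : Tendsto (fun n : ℕ => C * (1 / 2 : ℝ) ^ n) atTop (𝓝 0) := by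
      simpa using (tendsto_pow_atTop_nhds_zero_of_lt_one (by norm_num : (0 : ℝ) ≤ 1 / 2)
        (by norm_num)).const_mul C
    exact le_antisymm (ge_of_tendsto' hlim fun n => hhalf n u hu.le) (hf u)
  exact absurd (ha.1 hbA) (not_le.2 hab)

/-- Pathwise form of the result: if no value `f t * g t` exceeded `∫_0^t f dg`, then, `g` being
bounded below by a positive constant, Gronwall's inequality would force `f = 0`. -/
lemma exists_hasRSIntegralUpTo_lt {g : TimeInterval T → ℝ} (hf : IsFiniteVariation f)
    (hf0 : ∀ t, 0 ≤ f t) (hg : IsFiniteVariation g) (hgc : Continuous g) (hg0 : ∀ t, 0 < g t)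
    (hne : ∃ t, 0 < f t) : ∃ t I, HasRSIntegralUpTo f g t I ∧ I < f t * g t := by
  obtain ⟨μ, hμ, hμ0, hI⟩ := exists_measure_hasRSIntegralUpTo hf hg hgc
  by_contra! hcon
  obtain ⟨m, -, hm⟩ := isCompact_univ.exists_isMinOn Set.univ_nonempty hgc.continuousOn
  obtain ⟨C, hC⟩ := hf.exists_abs_le
  obtain ⟨t, ht⟩ := hne
  refine ht.ne' (eq_zero_of_le_setIntegral_Iic (μ := μ) (L := (g m)⁻¹) hf0
    (fun s => (le_abs_self _).trans (hC s)) (inv_nonneg.2 (hg0 m).le) (fun s => ?_) t)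
  obtain ⟨I, hIs, hIle⟩ := hI s
  rw [← div_eq_inv_mul, le_div_iff₀ (hg0 m)]
  calc f s * g m ≤ f s * g s :=
        mul_le_mul_of_nonneg_left (isMinOn_iff.1 hm s (Set.mem_univ s)) (hf0 s)
    _ ≤ I := hcon s I hIs
    _ ≤ _ := hIle hf0

end Gronwall

theorem proposition1 {Ω : Type*} {mΩ : MeasurableSpace Ω} (P : Measure Ω) [IsProbabilityMeasure P]
    (T : ℝ≥0) (hT : 0 < T)
    (𝓕 : Filtration (TimeInterval T) mΩ)
    (S V φ : TimeInterval T → Ω → ℝ)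
    (hS : IsContinuousSemimartingale 𝓕 P S)
    (hS_pos : ∀ᵐ ω ∂P, ∀ t, 0 < S t ω)
    (hV : IsQuadraticVariation 𝓕 P S V)
    (hV_zero : ∀ᵐ ω ∂P, V ⊤ ω = 0)
    (hφ_meas : ∀ t, Measurable (φ t))
    (hφ_caglad : ∀ᵐ ω ∂P, IsCaglad fun t => φ t ω)
    (hφ_fv : ∀ᵐ ω ∂P, IsFiniteVariation fun t => φ t ω)
    (hφ_nonneg : ∀ᵐ ω ∂P, ∀ t, 0 ≤ φ t ω)
    (hφ_pos : 0 < P {ω | ∃ t, 0 < φ t ω}) :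
    (∀ᵐ ω ∂P, ∀ t, ∃ I : ℝ, HasRSIntegralUpTo (fun u => φ u ω) (fun u => S u ω) t I) ∧
      0 < P {ω | ∃ t, ∃ I : ℝ,
        HasRSIntegralUpTo (fun u => φ u ω) (fun u => S u ω) t I ∧ I < φ t ω * S t ω} := by
  have hSpath := hV.continuous_and_finiteVariation hV_zero
  constructor
  · filter_upwards [hSpath, hφ_fv] with ω hSω hφω t
    obtain ⟨μ, -, -, hI⟩ := exists_measure_hasRSIntegralUpTo hφω hSω.2 hSω.1
    obtain ⟨I, hI, -⟩ := hI t
    exact ⟨I, hI⟩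
  · refine hφ_pos.trans_le (measure_mono_ae ?_)
    filter_upwards [hSpath, hS_pos, hφ_fv, hφ_nonneg] with ω hSω hpos hφω hnonneg hne
    exact exists_hasRSIntegralUpTo_lt hφω hnonneg hSω.2 hSω.1 hpos hne
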